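/- Let $p>5$ be a prime. For a rational number $x$ and an integer $n\ge 0$ write $(x)_n=x(x+1)\cdots(x+n-1)$ (so $(x)_0=1$), and for integers $\ell,m\ge1$ write $H_m^{(\ell)}=\sum_{k=1}^{m}1/k^{\ell}$. Let $\Gamma_p:\mathbb{Z}_p\to\mathbb{Z}_p$ be Morita's $p$-adic Gamma function: $\Gamma_p(0)=1$, $\Gamma_p(n)=(-1)^n\prod_{1\le k<n,\ p\nmid k}k$ for integers $n\ge 1$, and $\Gamma_p(x)=\lim_{n\in\mathbb{N},\ |x-n|_p\to0}\Gamma_p(n)$ for $x\in\mathbb{Z}_p$. For $a,b\in\mathbb{Q}_p$, $a\equiv b\pmod{p^e}$ means $a-b\in p^e\mathbb{Z}_p$. If $p\equiv 1\pmod 4$, then $$\frac{(1/2)_{(p-1)/4}^2}{\big((p-1)/4\big)!^2}\Big\{1+\frac{p^2}{4}H^{(2)}_{(p-1)/2}-\frac{p^2}{8}H^{(2)}_{(p-1)/4}\Big\}\equiv-\Gamma_p(1/4)^4\pmod{p^4}.$$ If $p\equiv 3\pmod 4$, then $$\frac{(3/4)_{(p-1)/2}}{(5/4)_{(p-1)/2}}\equiv-\frac{p}{16}\,\Gamma_p(1/4)^4\pmod{p^3}.$$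 -/

import Mathlib

/-- Morita's `p`-adic Gamma function at a natural number:
`Γ_p(0) = 1` and `Γ_p(n) = (-1)^n ∏_{1 ≤ k < n, p ∤ k} k` for `n ≥ 1`. -/
def padicGammaNat (p n : ℕ) : ℤ :=
  (-1) ^ n * ∏ k ∈ (Finset.Ico 1 n).filter (fun k => ¬ p ∣ k), (k : ℤ)

/-- Morita's `p`-adic Gamma function on `ℤ_[p]`: the limit of `Γ_p(n)` as the natural number `n`
tends `p`-adically to `x`. The filter is proper because `ℕ` is dense in `ℤ_[p]`,
and the limit exists for every odd prime `p`. -/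
noncomputable def padicGamma (p : ℕ) [Fact p.Prime] (x : ℤ_[p]) : ℤ_[p] :=
  Filter.limUnder (Filter.comap (fun n : ℕ => (n : ℤ_[p])) (nhds x))
    (fun n : ℕ => (padicGammaNat p n : ℤ_[p]))

/-- The shifted factorial `(x)_n = x (x + 1) ⋯ (x + n - 1)` of a rational number. -/
noncomputable def shiftedFactorial (x : ℚ) (n : ℕ) : ℚ := (ascPochhammer ℚ n).eval x

/-- The harmonic number of order `l`: `H_m^{(l)} = ∑_{k=1}^m 1 / k^l`. -/
def harmonicOrder (l m : ℕ) : ℚ := ∑ k ∈ Finset.Icc 1 m, 1 / (k : ℚ) ^ l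

/-- Congruence modulo `p ^ e` of `p`-adic numbers: the difference lies in `p ^ e ℤ_[p]`. -/
def PadicCongr (p : ℕ) [Fact p.Prime] (e : ℕ) (x y : ℚ_[p]) : Prop :=
  ∃ z : ℤ_[p], x - y = (p : ℚ_[p]) ^ e * (z : ℚ_[p])

/-! Write `q = 1/4`. The functional and reflection equations of `Γ_p` turn each quotient of shifted
factorials into values of `Γ_p` at the two ends of a progression centred at `q` with step divisible
by `p`.

If `p = 4n + 1`, the progression is `-n`, `q`, `n + 1/2`, with step `p/4`. Since `Γ_p(1/2)² = -1`
and `Γ_p(1 + n) Γ_p(-n) = ±1`, the quotient `(1/2)_n² / n!²` is `-(Γ_p(-n) Γ_p(n + 1/2))²`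
(`prod_half_sq_eq`). If `p = 4r + 3`, it is `q - p/2`, `q`, `q + p/2`. The factor `3/4 + r = p/4` is
the only one divisible by `p`, and it supplies the `p` of the right-hand side
(`prod_three_quarters_eq`).

It remains to compare `Γ_p(x) Γ_p(x + 2pt)` with `Γ_p(x + pt)²`. This is
`padicGamma_second_difference`: modulo `p⁴` the ratio is given by the sums of inverses and of
inverse squares over `p` consecutive integers from `x`. For `p ≡ 3 (mod 4)` it is enough that the
ratio is `1` modulo `p²`. For `p ≡ 1 (mod 4)` Wolstenholme-type congruences
(`invPowerSum_quarter_congr`) turn these sums into `H^{(2)}` at `2n` and `n`, and the braces cancel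
them. -/

/-! ### Residue systems and Wilson's theorem for prime powers -/

/-- A product over `N` consecutive residues is the product over all of `ZMod N`. -/
theorem ZMod.prod_range_add_natCast {M : Type*} [CommMonoid M] (N : ℕ) [NeZero N] (c : ZMod N)
    (f : ZMod N → M) : ∏ i ∈ Finset.range N, f (c + (i : ZMod N)) = ∏ a, f a := by
  rw [← Equiv.prod_comp (Equiv.addLeft c) f]
  refine Finset.prod_nbij' (fun i => (i : ZMod N)) ZMod.val ?_ ?_ ?_ ?_ ?_
  · simp
  · intro a _
    exact Finset.mem_range.2 (ZMod.val_lt a)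
  · intro i hi
    exact ZMod.val_cast_of_lt (Finset.mem_range.1 hi)
  · intro a _
    simp
  · intro i _
    simp

/-- A sum over `N` consecutive residues is the sum over all of `ZMod N`. -/
theorem ZMod.sum_range_add_natCast {M : Type*} [AddCommMonoid M] (N : ℕ) [NeZero N] (c : ZMod N)
    (f : ZMod N → M) : ∑ i ∈ Finset.range N, f (c + (i : ZMod N)) = ∑ a, f a :=
  ZMod.prod_range_add_natCast (M := Multiplicative M) N c f

theorem ZMod.isUnit_natCast_prime_pow_iff {p : ℕ} (hp : p.Prime) {k : ℕ} (hk : 1 ≤ k) (n : ℕ) :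
    IsUnit (n : ZMod (p ^ k)) ↔ ¬ p ∣ n := by
  rw [ZMod.isUnit_iff_coprime, Nat.coprime_pow_right_iff hk, Nat.coprime_comm,
    hp.coprime_iff_not_dvd]

/-- In `ℤ / p ^ k` with `p` odd, the only square roots of one are `1` and `-1`. -/
theorem ZMod.sq_eq_one_prime_pow {p : ℕ} (hp : p.Prime) (hp2 : p ≠ 2) {k : ℕ}
    (a : ZMod (p ^ k)) (h : a * a = 1) : a = 1 ∨ a = -1 := by
  obtain ⟨z, rfl⟩ := ZMod.intCast_surjective a
  have h1 : ((p ^ k : ℕ) : ℤ) ∣ (z - 1) * (z + 1) := by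
    rw [← ZMod.intCast_zmod_eq_zero_iff_dvd]
    push_cast
    linear_combination h
  have hpz : Prime (p : ℤ) := Nat.prime_iff_prime_int.1 hp
  push_cast at h1
  by_cases hd : (p : ℤ) ∣ z - 1
  · left
    have hnd : ¬ (p : ℤ) ∣ z + 1 := by
      intro hd'
      have h2 : (p : ℤ) ∣ 2 := by
        have := dvd_sub hd' hd
        ring_nf at this
        exact this
      have h3 : p ∣ 2 := by exact_mod_cast h2
      exact hp2 ((Nat.prime_dvd_prime_iff_eq hp Nat.prime_two).1 h3)
    have h4 : (p : ℤ) ^ k ∣ z - 1 := hpz.pow_dvd_of_dvd_mul_right k hnd h1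
    have h5 : ((z - 1 : ℤ) : ZMod (p ^ k)) = 0 := by
      rw [ZMod.intCast_zmod_eq_zero_iff_dvd]
      exact_mod_cast h4
    push_cast at h5
    linear_combination h5
  · right
    have h4 : (p : ℤ) ^ k ∣ z + 1 := hpz.pow_dvd_of_dvd_mul_left k hd h1
    have h5 : ((z + 1 : ℤ) : ZMod (p ^ k)) = 0 := by
      rw [ZMod.intCast_zmod_eq_zero_iff_dvd]
      exact_mod_cast h4
    push_cast at h5
    linear_combination h5

/-- **Wilson's theorem** modulo odd prime powers. -/
theorem ZMod.prod_units_prime_pow {p : ℕ} [Fact p.Prime] (hp2 : p ≠ 2) (k : ℕ) :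
    ∏ u : (ZMod (p ^ k))ˣ, u = -1 := by
  classical
  have hp : p.Prime := Fact.out
  rw [← Finset.mul_prod_erase Finset.univ _ (Finset.mem_univ (-1 : (ZMod (p ^ k))ˣ))]
  -- With `-1` set aside, `u` and `u⁻¹` cancel in pairs; a remaining fixed point can only be `1`.
  rw [Finset.prod_involution (fun u _ => u⁻¹), mul_one]
  · intro a _
    simp
  · intro a ha ha1 h
    have h2 : a * a = 1 := by
      nth_rewrite 2 [← h]
      simp
    have h3 : (a : ZMod (p ^ k)) * a = 1 := by
      rw [← Units.val_mul, h2, Units.val_one]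
    rcases ZMod.sq_eq_one_prime_pow hp hp2 _ h3 with h4 | h4
    · exact ha1 (Units.ext h4)
    · exact (Finset.mem_erase.1 ha).1 (Units.ext (by simpa using h4))
  · intro a ha
    refine Finset.mem_erase.2 ⟨fun h => (Finset.mem_erase.1 ha).1 ?_, Finset.mem_univ _⟩
    rw [inv_eq_iff_eq_inv] at h
    simpa using h
  · intro a _
    simp

-- One full period of the step factors of `Γ_p`: the odd number `p ^ k` of signs gives `-1`, and
-- Wilson's theorem gives another `-1`.
open Classical in
theorem ZMod.prod_neg_of_isUnit_prime_pow {p : ℕ} [Fact p.Prime] (hp2 : p ≠ 2) (k : ℕ) :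
    ∏ a : ZMod (p ^ k), (if IsUnit a then -a else -1) = 1 := by
  have hp : p.Prime := Fact.out
  have h1 : ∀ a : ZMod (p ^ k), (if IsUnit a then -a else -1) = -1 * (if IsUnit a then a else 1) := by
    intro a
    split_ifs <;> simp
  simp_rw [h1]
  rw [Finset.prod_mul_distrib, Finset.prod_const, Finset.card_univ, ZMod.card,
    Odd.neg_one_pow ((hp.odd_of_ne_two hp2).pow)]
  have h2 : ∏ a : ZMod (p ^ k), (if IsUnit a then a else 1)
      = ∏ u : (ZMod (p ^ k))ˣ, (u : ZMod (p ^ k)) := by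
    rw [← Finset.prod_filter]
    symm
    refine Finset.prod_bij (fun u _ => (u : ZMod (p ^ k))) ?_ ?_ ?_ ?_
    · intro u _
      simp
    · intro u _ v _ h
      exact Units.ext h
    · intro a ha
      obtain ⟨u, rfl⟩ := (Finset.mem_filter.1 ha).2
      exact ⟨u, Finset.mem_univ _, rfl⟩
    · intro u _
      rfl
  have h3 := congrArg (Units.coeHom (ZMod (p ^ k))) (ZMod.prod_units_prime_pow hp2 k)
  rw [map_prod] at h3
  simp only [Units.coeHom_apply] at h3
  rw [h2, h3]
  simp

/-! ### Morita's Gamma function on natural numbers -/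

theorem padicGammaNat_zero (p : ℕ) : padicGammaNat p 0 = 1 := by simp [padicGammaNat]

theorem padicGammaNat_succ (p n : ℕ) :
    padicGammaNat p (n + 1) = (if p ∣ n then -1 else -(n : ℤ)) * padicGammaNat p n := by
  unfold padicGammaNat
  rcases Nat.eq_zero_or_pos n with rfl | hn
  · simp
  · rw [Finset.prod_filter, Finset.prod_filter, Finset.prod_Ico_succ_top hn, pow_succ]
    split_ifs <;> simp_all
    ring

theorem padicGammaNat_add (p n m : ℕ) :
    padicGammaNat p (n + m) = padicGammaNat p n *
      ∏ i ∈ Finset.range m, (if p ∣ n + i then -1 else -((n + i : ℕ) : ℤ)) := by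
  induction m with
  | zero => simp
  | succ m ih =>
    rw [← add_assoc, padicGammaNat_succ, ih, Finset.prod_range_succ]
    ring

theorem padicGammaNat_add_prime_pow {p : ℕ} [Fact p.Prime] (hp2 : p ≠ 2) (k : ℕ) (hk : 1 ≤ k)
    (n : ℕ) : (padicGammaNat p (n + p ^ k) : ZMod (p ^ k)) = padicGammaNat p n := by
  classical
  have hp : p.Prime := Fact.out
  rw [padicGammaNat_add, Int.cast_mul, Int.cast_prod]
  have h : ∀ i ∈ Finset.range (p ^ k),
      (((if p ∣ n + i then -1 else -((n + i : ℕ) : ℤ)) : ℤ) : ZMod (p ^ k)) =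
      (fun a : ZMod (p ^ k) => if IsUnit a then -a else -1) ((n : ZMod (p ^ k)) + (i : ZMod (p ^ k))) := by
    intro i _
    have h1 := ZMod.isUnit_natCast_prime_pow_iff hp hk (n + i)
    push_cast at h1
    by_cases hd : p ∣ n + i <;> simp [hd, h1]
  rw [Finset.prod_congr rfl h, ZMod.prod_range_add_natCast (p ^ k) (n : ZMod (p ^ k))
    (fun a : ZMod (p ^ k) => if IsUnit a then -a else -1),
    ZMod.prod_neg_of_isUnit_prime_pow hp2 k, mul_one]

/-- Periodicity modulo `p ^ k` amounts to uniform continuity on `ℕ`, whence the limit defining `Γ_p`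
exists. -/
theorem padicGammaNat_modEq {p : ℕ} [Fact p.Prime] (hp2 : p ≠ 2) {k : ℕ} (hk : 1 ≤ k)
    {n m : ℕ} (h : n ≡ m [MOD p ^ k]) : padicGammaNat p n ≡ padicGammaNat p m [ZMOD p ^ k] := by
  have key : ∀ j n : ℕ, (padicGammaNat p (n + p ^ k * j) : ZMod (p ^ k)) = padicGammaNat p n := by
    intro j n
    induction j with
    | zero => simp
    | succ j ih => rw [mul_add, mul_one, ← add_assoc, padicGammaNat_add_prime_pow hp2 k hk, ih]
  have h3 : ∀ n : ℕ, (padicGammaNat p n : ZMod (p ^ k)) = padicGammaNat p (n % p ^ k) := by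
    intro n
    conv_lhs => rw [← Nat.mod_add_div n (p ^ k)]
    exact key _ _
  have h2 : (padicGammaNat p n : ZMod (p ^ k)) = padicGammaNat p m := by
    rw [h3 n, h3 m, show n % p ^ k = m % p ^ k from h]
  have := (ZMod.intCast_eq_intCast_iff _ _ _).1 h2
  exact_mod_cast this

/-! ### Morita's Gamma function on `ℤ_[p]` -/

/-! ### Divisibility by powers of `p`, units and inverses in `ℤ_[p]`. -/

namespace PadicInt

variable {p : ℕ} [Fact p.Prime]

theorem norm_le_pow_iff_pow_dvd (x : ℤ_[p]) (k : ℕ) :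
    ‖x‖ ≤ (p : ℝ) ^ (-k : ℤ) ↔ (p : ℤ_[p]) ^ k ∣ x := by
  rw [norm_le_pow_iff_mem_span_pow, Ideal.mem_span_singleton]

theorem exists_natCast_pow_dvd_sub (x : ℤ_[p]) (k : ℕ) : ∃ n : ℕ, (p : ℤ_[p]) ^ k ∣ x - n :=
  ⟨x.appr k, Ideal.mem_span_singleton.1 (appr_spec k x)⟩

theorem eq_zero_of_forall_pow_dvd {x : ℤ_[p]} (h : ∀ k : ℕ, 1 ≤ k → (p : ℤ_[p]) ^ k ∣ x) :
    x = 0 := by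
  by_contra hx
  obtain ⟨k, hk⟩ := exists_pow_neg_lt p (norm_pos_iff.2 hx)
  have h1 := (norm_le_pow_iff_pow_dvd x k).2 (dvd_trans (pow_dvd_pow _ (Nat.le_succ k))
    (h (k + 1) (by omega)))
  linarith

theorem not_isUnit_iff_dvd {x : ℤ_[p]} : ¬ IsUnit x ↔ (p : ℤ_[p]) ∣ x := by
  rw [not_isUnit_iff, norm_lt_one_iff_dvd]

theorem isUnit_natCast_iff {n : ℕ} : IsUnit (n : ℤ_[p]) ↔ ¬ p ∣ n := by
  have h := pow_p_dvd_int_iff (p := p) 1 n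
  rw [pow_one, pow_one] at h
  rw [← not_iff_not, not_isUnit_iff_dvd, not_not]
  exact_mod_cast h

theorem inv_mul_of_isUnit {x : ℤ_[p]} (hx : IsUnit x) : x.inv * x = 1 := inv_mul (isUnit_iff.1 hx)

/-- This default value makes sums of inverses skip the multiples of `p` with no side condition. -/
theorem inv_of_not_isUnit {x : ℤ_[p]} (hx : ¬ IsUnit x) : x.inv = 0 := by
  rw [isUnit_iff] at hx
  obtain ⟨y, hy⟩ := x
  exact dif_neg hx

theorem isUnit_add_iff {x y : ℤ_[p]} (hy : (p : ℤ_[p]) ∣ y) : IsUnit (x + y) ↔ IsUnit x := by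
  rw [← not_iff_not, not_isUnit_iff_dvd, not_isUnit_iff_dvd]
  exact dvd_add_left hy

end PadicInt

open PadicInt

/-! ### Existence of the limit, Lipschitz bound and functional equation. -/

section Morita

variable {p : ℕ} [Fact p.Prime]

theorem pow_dvd_padicGammaNat_sub (hp2 : p ≠ 2) {k : ℕ} (hk : 1 ≤ k) {n m : ℕ}
    (h : (p : ℤ_[p]) ^ k ∣ (n : ℤ_[p]) - m) :
    (p : ℤ_[p]) ^ k ∣ (padicGammaNat p n : ℤ_[p]) - padicGammaNat p m := by
  rw [← Int.cast_sub, pow_p_dvd_int_iff]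
  have h1 : (p : ℤ_[p]) ^ k ∣ (((m : ℤ) - n : ℤ) : ℤ_[p]) := by
    push_cast
    rw [← dvd_neg, neg_sub]
    exact h
  rw [pow_p_dvd_int_iff] at h1
  have h2 : n ≡ m [MOD p ^ k] := (Nat.modEq_iff_dvd).2 (by exact_mod_cast h1)
  exact (padicGammaNat_modEq hp2 hk h2).symm.dvd

theorem comap_natCast_nhds_neBot (x : ℤ_[p]) :
    (Filter.comap (fun n : ℕ => (n : ℤ_[p])) (nhds x)).NeBot :=
  Filter.comap_neBot fun _ ht => denseRange_natCast.mem_nhds ht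

theorem eventually_pow_dvd_sub_natCast (x : ℤ_[p]) (k : ℕ) :
    ∀ᶠ n : ℕ in Filter.comap (fun n : ℕ => (n : ℤ_[p])) (nhds x), (p : ℤ_[p]) ^ k ∣ x - n := by
  have hp : (0 : ℝ) < p := by exact_mod_cast (Fact.out : p.Prime).pos
  refine Filter.mem_comap.2 ⟨Metric.ball x ((p : ℝ) ^ (-k : ℤ)),
    Metric.ball_mem_nhds _ (zpow_pos hp _), ?_⟩
  intro n hn
  have h1 : dist (n : ℤ_[p]) x < (p : ℝ) ^ (-k : ℤ) := hn
  rw [dist_comm, dist_eq_norm] at h1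
  exact (norm_le_pow_iff_pow_dvd _ _).1 h1.le

theorem tendsto_padicGamma (hp2 : p ≠ 2) (x : ℤ_[p]) :
    Filter.Tendsto (fun n : ℕ => (padicGammaNat p n : ℤ_[p]))
      (Filter.comap (fun n : ℕ => (n : ℤ_[p])) (nhds x)) (nhds (padicGamma p x)) := by
  have := comap_natCast_nhds_neBot x
  refine tendsto_nhds_limUnder ?_
  rw [← cauchy_map_iff_exists_tendsto, Metric.cauchy_iff]
  refine ⟨inferInstance, fun ε hε => ?_⟩
  obtain ⟨k, hk⟩ := exists_pow_neg_lt p hε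
  refine ⟨_, Filter.image_mem_map (eventually_pow_dvd_sub_natCast x (k + 1)), ?_⟩
  rintro _ ⟨n, hn, rfl⟩ _ ⟨m, hm, rfl⟩
  have h1 : (p : ℤ_[p]) ^ (k + 1) ∣ (n : ℤ_[p]) - m := by
    have := dvd_sub (show (p : ℤ_[p]) ^ (k + 1) ∣ x - m from hm)
      (show (p : ℤ_[p]) ^ (k + 1) ∣ x - n from hn)
    rwa [sub_sub_sub_cancel_left] at this
  have h2 := pow_dvd_padicGammaNat_sub hp2 (by omega) h1
  rw [dist_eq_norm]
  exact lt_of_le_of_lt ((norm_le_pow_iff_pow_dvd _ k).2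
    (dvd_trans (pow_dvd_pow _ (Nat.le_succ k)) h2)) hk

theorem pow_dvd_padicGamma_sub_natCast (hp2 : p ≠ 2) {k : ℕ} (hk : 1 ≤ k) {x : ℤ_[p]} {n : ℕ}
    (h : (p : ℤ_[p]) ^ k ∣ x - n) :
    (p : ℤ_[p]) ^ k ∣ padicGamma p x - padicGammaNat p n := by
  have := comap_natCast_nhds_neBot x
  rw [← norm_le_pow_iff_pow_dvd]
  refine le_of_tendsto (((tendsto_padicGamma hp2 x).sub_const _).norm) ?_
  filter_upwards [eventually_pow_dvd_sub_natCast x k] with m hm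
  rw [norm_le_pow_iff_pow_dvd]
  refine pow_dvd_padicGammaNat_sub hp2 hk ?_
  have := dvd_sub h hm
  rwa [sub_sub_sub_cancel_left] at this

/-- Morita's Gamma function is `1`-Lipschitz at distances less than one. -/
theorem pow_dvd_padicGamma_sub (hp2 : p ≠ 2) {k : ℕ} (hk : 1 ≤ k) {x y : ℤ_[p]}
    (h : (p : ℤ_[p]) ^ k ∣ x - y) : (p : ℤ_[p]) ^ k ∣ padicGamma p x - padicGamma p y := by
  obtain ⟨n, hn⟩ := exists_natCast_pow_dvd_sub y k
  have h1 : (p : ℤ_[p]) ^ k ∣ x - n := by simpa using dvd_add h hn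
  have := dvd_sub (pow_dvd_padicGamma_sub_natCast hp2 hk h1)
    (pow_dvd_padicGamma_sub_natCast hp2 hk hn)
  simpa using this

theorem padicGamma_natCast (hp2 : p ≠ 2) (n : ℕ) : padicGamma p n = padicGammaNat p n := by
  rw [← sub_eq_zero]
  exact eq_zero_of_forall_pow_dvd fun k hk => pow_dvd_padicGamma_sub_natCast hp2 hk (by simp)

open Classical in
/-- The factor in the functional equation of Morita's Gamma function. -/
noncomputable def padicGammaStep (x : ℤ_[p]) : ℤ_[p] := if IsUnit x then -x else -1

theorem padicGammaStep_of_isUnit {x : ℤ_[p]} (hx : IsUnit x) : padicGammaStep x = -x := if_pos hx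

theorem padicGammaStep_of_not_isUnit {x : ℤ_[p]} (hx : ¬ IsUnit x) : padicGammaStep x = -1 :=
  if_neg hx

/-- Valid for non-units too, because `x.inv = 0` there. -/
theorem padicGammaStep_add (x : ℤ_[p]) {y : ℤ_[p]} (hy : (p : ℤ_[p]) ∣ y) :
    padicGammaStep (x + y) = padicGammaStep x * (1 + y * x.inv) := by
  by_cases hx : IsUnit x
  · rw [padicGammaStep_of_isUnit hx, padicGammaStep_of_isUnit ((isUnit_add_iff hy).2 hx)]
    linear_combination y * inv_mul_of_isUnit hx
  · rw [padicGammaStep_of_not_isUnit hx,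
      padicGammaStep_of_not_isUnit (fun h => hx ((isUnit_add_iff hy).1 h)), inv_of_not_isUnit hx]
    ring

/-- The functional equation of Morita's Gamma function. -/
theorem padicGamma_add_one (hp2 : p ≠ 2) (x : ℤ_[p]) :
    padicGamma p (x + 1) = padicGammaStep x * padicGamma p x := by
  rw [← sub_eq_zero]
  refine eq_zero_of_forall_pow_dvd fun k hk => ?_
  obtain ⟨n, hn⟩ := exists_natCast_pow_dvd_sub x k
  have h1 : (p : ℤ_[p]) ^ k ∣ (x + 1) - (n + 1 : ℕ) := by simpa using hn
  obtain ⟨a, ha⟩ := pow_dvd_padicGamma_sub_natCast hp2 hk h1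
  obtain ⟨b, hb⟩ := pow_dvd_padicGamma_sub_natCast hp2 hk hn
  have hpd : (p : ℤ_[p]) ∣ x - n := dvd_trans (dvd_pow_self _ (by omega)) hn
  have h2 : padicGammaStep x = padicGammaStep (n : ℤ_[p]) * (1 + (x - n) * (n : ℤ_[p]).inv) := by
    rw [← padicGammaStep_add _ hpd]
    congr 1
    ring
  have h3 : (padicGammaNat p (n + 1) : ℤ_[p]) =
      padicGammaStep (n : ℤ_[p]) * padicGammaNat p n := by
    rw [padicGammaNat_succ]
    by_cases hd : p ∣ n
    · rw [padicGammaStep_of_not_isUnit (by rwa [isUnit_natCast_iff, not_not])]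
      simp [hd]
    · rw [padicGammaStep_of_isUnit (by rwa [isUnit_natCast_iff])]
      simp [hd]
  obtain ⟨c, hc⟩ := hn
  rw [h2, hc]
  refine ⟨a - padicGammaStep (n : ℤ_[p]) * (b + c * (n : ℤ_[p]).inv * padicGamma p x), ?_⟩
  linear_combination ha - padicGammaStep (n : ℤ_[p]) * hb + h3

theorem padicGamma_zero (hp2 : p ≠ 2) : padicGamma p 0 = 1 := by
  simpa [padicGammaNat_zero] using padicGamma_natCast hp2 0

theorem padicGamma_one (hp2 : p ≠ 2) : padicGamma p 1 = -1 := by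
  have h := padicGamma_add_one hp2 0
  rw [zero_add, padicGamma_zero hp2, padicGammaStep_of_not_isUnit not_isUnit_zero] at h
  simpa using h

theorem padicGamma_add_natCast (hp2 : p ≠ 2) (x : ℤ_[p]) (m : ℕ) :
    padicGamma p (x + m) = padicGamma p x * ∏ i ∈ Finset.range m, padicGammaStep (x + (i : ℤ_[p])) := by
  induction m with
  | zero => simp
  | succ m ih =>
    rw [Nat.cast_succ, ← add_assoc, padicGamma_add_one hp2, ih, Finset.prod_range_succ]
    ring

/-! ### The reflection formula -/

/-- For a unit `n` the steps at `n` and `-n` have factors `-n` and `n`, so passing from `n` to `n +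
1` flips the sign. -/
theorem padicGamma_reflection_natCast (hp2 : p ≠ 2) {n : ℕ} (hn : 1 ≤ n) (hnp : n ≤ p) :
    padicGamma p n * padicGamma p (1 - n) = (-1) ^ n := by
  induction n, hn using Nat.le_induction with
  | base => simp [padicGamma_zero hp2, padicGamma_one hp2]
  | succ n hn ih =>
    have hu : IsUnit (n : ℤ_[p]) :=
      isUnit_natCast_iff.2 (fun h => by have := Nat.le_of_dvd (by omega) h; omega)
    have h1 := padicGamma_add_one hp2 (n : ℤ_[p])
    have h2 := padicGamma_add_one hp2 (-(n : ℤ_[p]))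
    rw [padicGammaStep_of_isUnit hu] at h1
    rw [padicGammaStep_of_isUnit hu.neg, neg_neg, neg_add_eq_sub] at h2
    rw [Nat.cast_succ, h1, show (1 : ℤ_[p]) - (n + 1) = -n by ring, pow_succ, ← ih (by omega), h2]
    ring

/-- Squaring hides that the sign flips at units only, so the induction runs over all of `ℕ`; density
then reaches every `x`. -/
theorem padicGamma_reflection_sq_natCast (hp2 : p ≠ 2) (n : ℕ) :
    (padicGamma p n * padicGamma p (1 - n)) ^ 2 = 1 := by
  induction n with
  | zero => simp [padicGamma_zero hp2, padicGamma_one hp2]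
  | succ n ih =>
    have h1 := padicGamma_add_one hp2 (n : ℤ_[p])
    have h2 := padicGamma_add_one hp2 (-(n : ℤ_[p]))
    rw [neg_add_eq_sub] at h2
    rw [Nat.cast_succ, h1, show (1 : ℤ_[p]) - (n + 1) = -n by ring, ← ih, h2]
    by_cases hu : IsUnit (n : ℤ_[p])
    · rw [padicGammaStep_of_isUnit hu, padicGammaStep_of_isUnit hu.neg]
      ring
    · rw [padicGammaStep_of_not_isUnit hu,
        padicGammaStep_of_not_isUnit (fun h => hu (neg_neg (n : ℤ_[p]) ▸ h.neg))]
      ring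

theorem padicGamma_reflection_sq (hp2 : p ≠ 2) (x : ℤ_[p]) :
    (padicGamma p x * padicGamma p (1 - x)) ^ 2 = 1 := by
  rw [← sub_eq_zero]
  refine eq_zero_of_forall_pow_dvd fun k hk => ?_
  obtain ⟨n, hn⟩ := exists_natCast_pow_dvd_sub x k
  have hn' : (p : ℤ_[p]) ^ k ∣ (1 - x) - (1 - n) := by
    rw [← dvd_neg]
    simpa using hn
  have h1 : padicGamma p x ≡ padicGamma p n [SMOD Ideal.span {(p : ℤ_[p]) ^ k}] :=
    SModEq.sub_mem.2 (Ideal.mem_span_singleton.2 (pow_dvd_padicGamma_sub hp2 hk hn))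
  have h2 : padicGamma p (1 - x) ≡ padicGamma p (1 - n) [SMOD Ideal.span {(p : ℤ_[p]) ^ k}] :=
    SModEq.sub_mem.2 (Ideal.mem_span_singleton.2 (pow_dvd_padicGamma_sub hp2 hk hn'))
  have h3 := (h1.mul h2).pow 2
  rw [padicGamma_reflection_sq_natCast hp2] at h3
  exact Ideal.mem_span_singleton.1 (SModEq.sub_mem.1 h3)

theorem not_prime_dvd_two (hp2 : p ≠ 2) : ¬ (p : ℤ_[p]) ∣ 2 := by
  have h : IsUnit ((2 : ℕ) : ℤ_[p]) := isUnit_natCast_iff.2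
    (fun h => hp2 ((Nat.prime_dvd_prime_iff_eq Fact.out Nat.prime_two).1 h))
  exact fun hd => not_isUnit_iff_dvd.2 (by exact_mod_cast hd) h

/-- Two signs that agree modulo an odd prime `p` are equal. -/
theorem eq_of_sq_eq_one_of_dvd_sub (hp2 : p ≠ 2) {a b : ℤ_[p]} (ha : a ^ 2 = 1) (hb : b ^ 2 = 1)
    (h : (p : ℤ_[p]) ∣ a - b) : a = b := by
  rcases sq_eq_one_iff.1 ha with rfl | rfl <;>
  rcases sq_eq_one_iff.1 hb with rfl | rfl
  · rfl
  · exact absurd (by norm_num at h; exact h) (not_prime_dvd_two hp2)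
  · exact absurd (by rw [← dvd_neg] at h; norm_num at h; exact h) (not_prime_dvd_two hp2)
  · rfl

/-- The product `Γ_p(x) Γ_p(1 - x)` only depends on `x` modulo `p`. -/
theorem padicGamma_reflection_congr (hp2 : p ≠ 2) {x y : ℤ_[p]} (h : (p : ℤ_[p]) ∣ x - y) :
    padicGamma p x * padicGamma p (1 - x) = padicGamma p y * padicGamma p (1 - y) := by
  refine eq_of_sq_eq_one_of_dvd_sub hp2 (padicGamma_reflection_sq hp2 x)
    (padicGamma_reflection_sq hp2 y) ?_
  obtain ⟨a, ha⟩ := pow_dvd_padicGamma_sub hp2 le_rfl ((pow_one (p : ℤ_[p])).symm ▸ h)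
  have h' : (p : ℤ_[p]) ∣ (1 - x) - (1 - y) := by
    rw [← dvd_neg]
    simpa using h
  obtain ⟨b, hb⟩ := pow_dvd_padicGamma_sub hp2 le_rfl ((pow_one (p : ℤ_[p])).symm ▸ h')
  exact ⟨a * padicGamma p (1 - x) + padicGamma p y * b,
    by linear_combination padicGamma p (1 - x) * ha + padicGamma p y * hb⟩

/-- **Reflection formula** for Morita's Gamma function. -/
theorem padicGamma_reflection (hp2 : p ≠ 2) {n : ℕ} (hn : 1 ≤ n) (hnp : n ≤ p) {x : ℤ_[p]}
    (h : (p : ℤ_[p]) ∣ x - n) : padicGamma p x * padicGamma p (1 - x) = (-1) ^ n := by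
  rw [padicGamma_reflection_congr hp2 h, padicGamma_reflection_natCast hp2 hn hnp]

theorem isUnit_padicGamma (hp2 : p ≠ 2) (x : ℤ_[p]) : IsUnit (padicGamma p x) := by
  refine IsUnit.of_mul_eq_one (padicGamma p (1 - x) * (padicGamma p x * padicGamma p (1 - x))) ?_
  linear_combination padicGamma_reflection_sq hp2 x

end Morita

/-! ### Expansion of products of linear factors -/

/-- Expansion of `∏ (1 + y uᵢ)` to third order, with the elementary symmetric functions given by
Newton's identities. -/
theorem exists_prod_one_add_mul {R ι : Type*} [CommRing R] (s : Finset ι) (u : ι → R) :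
    ∃ e₂ e₃ : R, 2 * e₂ = (∑ i ∈ s, u i) ^ 2 - ∑ i ∈ s, u i ^ 2 ∧
      6 * e₃ = (∑ i ∈ s, u i) ^ 3 - 3 * (∑ i ∈ s, u i) * (∑ i ∈ s, u i ^ 2)
        + 2 * ∑ i ∈ s, u i ^ 3 ∧
      ∀ y : R, ∃ r : R, ∏ i ∈ s, (1 + y * u i) =
        1 + y * (∑ i ∈ s, u i) + y ^ 2 * e₂ + y ^ 3 * e₃ + y ^ 4 * r := by
  classical
  induction s using Finset.induction_on with
  | empty => exact ⟨0, 0, by simp, by simp, fun y => ⟨0, by simp⟩⟩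
  | insert a s ha ih =>
    obtain ⟨e₂, e₃, h2, h3, h⟩ := ih
    simp only [Finset.sum_insert ha, Finset.prod_insert ha]
    refine ⟨e₂ + u a * ∑ i ∈ s, u i, e₃ + u a * e₂, ?_, ?_, fun y => ?_⟩
    · linear_combination h2
    · linear_combination h3 + 3 * u a * h2
    · obtain ⟨r, hr⟩ := h y
      exact ⟨r + u a * e₃ + y * u a * r, by rw [hr]; ring⟩

/-! ### Power sums of inverses over `p` consecutive integers. -/

section PowerSums

variable {p : ℕ} [Fact p.Prime]

theorem PadicInt.prime_dvd_iff_toZMod_eq_zero (x : ℤ_[p]) : (p : ℤ_[p]) ∣ x ↔ toZMod x = 0 := by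
  rw [← RingHom.mem_ker, ker_toZMod, maximalIdeal_eq_span_p, Ideal.mem_span_singleton]

theorem PadicInt.toZMod_inv (x : ℤ_[p]) : toZMod x.inv = (toZMod x)⁻¹ := by
  by_cases hx : IsUnit x
  · have h := congrArg toZMod (inv_mul_of_isUnit hx)
    rw [map_mul, map_one] at h
    exact eq_inv_of_mul_eq_one_left h
  · rw [inv_of_not_isUnit hx, (prime_dvd_iff_toZMod_eq_zero x).1 (not_isUnit_iff_dvd.1 hx)]
    simp

/-- The sum of the `k`-th powers of the inverses of the units among `p` consecutive `p`-adic
integers. -/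
noncomputable def invPowerSum (x : ℤ_[p]) (k : ℕ) : ℤ_[p] :=
  ∑ j ∈ Finset.range p, (x + (j : ℤ_[p])).inv ^ k

/-- Inversion permutes `ZMod p` (with `0⁻¹ = 0`), leaving the sum of all `k`-th powers in the field,
which vanishes for `k < p - 1`. -/
theorem prime_dvd_invPowerSum (x : ℤ_[p]) {k : ℕ} (hkp : k < p - 1) :
    (p : ℤ_[p]) ∣ invPowerSum x k := by
  rw [PadicInt.prime_dvd_iff_toZMod_eq_zero, invPowerSum, map_sum]
  simp only [map_pow, PadicInt.toZMod_inv, map_add, map_natCast]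
  rw [ZMod.sum_range_add_natCast p (toZMod x) (fun a => a⁻¹ ^ k)]
  have h := Equiv.sum_comp (Equiv.inv (ZMod p)) (fun a => a ^ k)
  simp only [Equiv.inv_apply] at h
  rw [h]
  exact FiniteField.sum_pow_lt_card_sub_one (ZMod p) k (by rwa [ZMod.card])

theorem isUnit_six (hp : 5 < p) : IsUnit (6 : ℤ_[p]) := by
  have hpp : p.Prime := Fact.out
  have h : IsUnit ((6 : ℕ) : ℤ_[p]) := by
    rw [isUnit_natCast_iff]
    intro h
    rcases (hpp.dvd_mul (m := 2) (n := 3)).1 h with h | h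
    · exact absurd (Nat.le_of_dvd (by norm_num) h) (by omega)
    · exact absurd (Nat.le_of_dvd (by norm_num) h) (by omega)
  exact_mod_cast h

theorem isUnit_two (hp : 5 < p) : IsUnit (2 : ℤ_[p]) :=
  isUnit_of_dvd_unit ⟨3, by norm_num⟩ (isUnit_six hp)

theorem isUnit_four (hp : 5 < p) : IsUnit (4 : ℤ_[p]) := by
  have := (isUnit_two hp).pow 2
  norm_num at this
  exact this

/-! ### The second difference of Morita's Gamma function -/

/-- Along the progression `x + p s`, the product of the step factors over one period is quadratic
in `s` modulo `p ^ 4`. -/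
theorem exists_prod_padicGammaStep (hp : 5 < p) (x : ℤ_[p]) :
    ∃ c₁ c₂ : ℤ_[p], invPowerSum x 1 = p * c₁ ∧
      2 * p * c₂ = invPowerSum x 1 ^ 2 - invPowerSum x 2 ∧
      ∀ s : ℤ_[p], ∃ r : ℤ_[p],
        ∏ j ∈ Finset.range p, padicGammaStep (x + (p : ℤ_[p]) * s + (j : ℤ_[p])) =
        (∏ j ∈ Finset.range p, padicGammaStep (x + (j : ℤ_[p]))) *
          (1 + (p : ℤ_[p]) ^ 2 * c₁ * s + p ^ 3 * c₂ * s ^ 2 + p ^ 4 * r) := by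
  obtain ⟨e₂, e₃, h2, h3, h⟩ := exists_prod_one_add_mul (Finset.range p)
    (fun j => (x + (j : ℤ_[p])).inv)
  obtain ⟨c₁, hc₁⟩ := prime_dvd_invPowerSum x (k := 1) (by omega)
  obtain ⟨d₂, hd₂⟩ := prime_dvd_invPowerSum x (k := 2) (by omega)
  obtain ⟨d₃, hd₃⟩ := prime_dvd_invPowerSum x (k := 3) (by omega)
  have hs1 : ∑ j ∈ Finset.range p, (x + (j : ℤ_[p])).inv = p * c₁ := by
    simpa [invPowerSum] using hc₁
  simp only [hs1, show ∑ j ∈ Finset.range p, (x + (j : ℤ_[p])).inv ^ 2 = p * d₂ from hd₂,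
    show ∑ j ∈ Finset.range p, (x + (j : ℤ_[p])).inv ^ 3 = p * d₃ from hd₃] at h2 h3 h
  obtain ⟨c₂, hc₂⟩ : (p : ℤ_[p]) ∣ e₂ := by
    refine (isUnit_two hp).dvd_mul_left.1 ⟨p * c₁ ^ 2 - d₂, ?_⟩
    linear_combination h2
  obtain ⟨c₃, hc₃⟩ : (p : ℤ_[p]) ∣ e₃ := by
    refine (isUnit_six hp).dvd_mul_left.1 ⟨p ^ 2 * c₁ ^ 3 - 3 * p * c₁ * d₂ + 2 * d₃, ?_⟩
    linear_combination h3
  refine ⟨c₁, c₂, hc₁, ?_, fun s => ?_⟩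
  · rw [hc₁, hd₂]
    linear_combination h2 - 2 * hc₂
  -- As `p` divides `e₃`, the cubic term at `y = p s` is already `O(p ^ 4)`.
  · obtain ⟨r, hr⟩ := h (p * s)
    refine ⟨s ^ 3 * c₃ + s ^ 4 * r, ?_⟩
    have h4 : ∀ j ∈ Finset.range p, padicGammaStep (x + (p : ℤ_[p]) * s + (j : ℤ_[p])) =
        padicGammaStep (x + (j : ℤ_[p])) * (1 + (p : ℤ_[p]) * s * (x + (j : ℤ_[p])).inv) := by
      intro j _
      rw [← padicGammaStep_add _ (dvd_mul_right _ _)]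
      congr 1
      ring
    rw [Finset.prod_congr rfl h4, Finset.prod_mul_distrib, hr, hc₂, hc₃]
    ring

/-- The second difference involves only the sum to `2t` minus twice the sum to `t`; this form avoids
dividing by `2` or `6`. -/
theorem sum_range_two_mul_id {R : Type*} [CommRing R] (t : ℕ) :
    ∑ s ∈ Finset.range (2 * t), (s : R) = 2 * (∑ s ∈ Finset.range t, (s : R)) + t ^ 2 := by
  induction t with
  | zero => simp
  | succ t ih =>
    rw [show 2 * (t + 1) = 2 * t + 1 + 1 by ring]
    simp only [Finset.sum_range_succ, ih]
    push_cast
    ring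

theorem sum_range_two_mul_sq {R : Type*} [CommRing R] (t : ℕ) :
    ∑ s ∈ Finset.range (2 * t), (s : R) ^ 2 =
      2 * (∑ s ∈ Finset.range t, (s : R) ^ 2) + t ^ 2 * (2 * t - 1) := by
  induction t with
  | zero => simp
  | succ t ih =>
    rw [show 2 * (t + 1) = 2 * t + 1 + 1 by ring]
    simp only [Finset.sum_range_succ, ih]
    push_cast
    ring

/-- The second difference of Morita's Gamma function along a progression with step `p t`. -/
theorem padicGamma_second_difference (hp : 5 < p) (x t : ℤ_[p]) :
    ∃ c₂ : ℤ_[p], 2 * p * c₂ = invPowerSum x 1 ^ 2 - invPowerSum x 2 ∧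
      (p : ℤ_[p]) ^ 4 ∣ padicGamma p x * padicGamma p (x + 2 * p * t) -
        padicGamma p (x + p * t) ^ 2 *
          (1 + p * invPowerSum x 1 * t ^ 2 + p ^ 3 * c₂ * (t ^ 2 * (2 * t - 1))) := by
  have hp2 : p ≠ 2 := by omega
  obtain ⟨c₁, c₂, hc₁, hc₂, h⟩ := exists_prod_padicGammaStep hp x
  refine ⟨c₂, hc₂, ?_⟩
  rw [hc₁]
  set φ := ∏ j ∈ Finset.range p, padicGammaStep (x + (j : ℤ_[p])) with hφ
  -- For natural `t`, multiply the `t` period products; products of two corrections are `O(p ^ 4)`.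
  have hstep : ∀ t : ℕ, ∃ r : ℤ_[p], padicGamma p (x + p * t) = padicGamma p x * φ ^ t *
      (1 + p ^ 2 * c₁ * (∑ s ∈ Finset.range t, (s : ℤ_[p])) +
        p ^ 3 * c₂ * (∑ s ∈ Finset.range t, (s : ℤ_[p]) ^ 2) + p ^ 4 * r) := by
    intro t
    induction t with
    | zero => exact ⟨0, by simp⟩
    | succ t ih =>
      obtain ⟨r, hr⟩ := ih
      obtain ⟨r', hr'⟩ := h t
      have h1 : padicGamma p (x + p * ((t + 1 : ℕ) : ℤ_[p])) =
          padicGamma p (x + p * t) *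
          ∏ j ∈ Finset.range p, padicGammaStep (x + (p : ℤ_[p]) * (t : ℤ_[p]) + (j : ℤ_[p])) := by
        rw [← padicGamma_add_natCast hp2]
        congr 1
        push_cast
        ring
      rw [h1, hr, hr', Finset.sum_range_succ, Finset.sum_range_succ]
      set A := ∑ s ∈ Finset.range t, (s : ℤ_[p])
      set B := ∑ s ∈ Finset.range t, (s : ℤ_[p]) ^ 2
      refine ⟨r + r' + (c₁ * A + p * c₂ * B + p ^ 2 * r) * (c₁ * t + p * c₂ * t ^ 2 + p ^ 2 * r'),
        ?_⟩
      ring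
  obtain ⟨n, hn⟩ := exists_natCast_pow_dvd_sub t 4
  have hnat : (p : ℤ_[p]) ^ 4 ∣ padicGamma p x * padicGamma p (x + 2 * p * n) -
        padicGamma p (x + p * n) ^ 2 *
          (1 + p * (p * c₁) * n ^ 2 + p ^ 3 * c₂ * (n ^ 2 * (2 * n - 1))) := by
    obtain ⟨r, hr⟩ := hstep n
    obtain ⟨r', hr'⟩ := hstep (2 * n)
    rw [sum_range_two_mul_id, sum_range_two_mul_sq,
      show x + p * ((2 * n : ℕ) : ℤ_[p]) = x + 2 * p * n by push_cast; ring] at hr'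
    rw [hr, hr']
    set A := ∑ s ∈ Finset.range n, (s : ℤ_[p])
    set B := ∑ s ∈ Finset.range n, (s : ℤ_[p]) ^ 2
    -- Here `Γ_p(x + p n) = Γ_p(x) φ ^ n (1 + p² a)`, and `1 + p² d` is the claimed ratio. The
    -- powers of `φ` agree on both sides.
    set a := c₁ * A + p * c₂ * B + p ^ 2 * r
    set d := c₁ * n ^ 2 + p * c₂ * (n ^ 2 * (2 * n - 1)) with hd
    refine ⟨padicGamma p x ^ 2 * φ ^ (2 * n) *
      (r' - 2 * r - a ^ 2 - d * (2 * a + p ^ 2 * a ^ 2)), ?_⟩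
    simp only [a, d]
    ring
  -- Pass from `n` to `t ≡ n` modulo `p ^ 4`, using the Lipschitz bound for the values of `Γ_p`.
  have hc : ∀ a b : ℤ_[p], (p : ℤ_[p]) ^ 4 ∣ a - b ↔ a ≡ b [SMOD Ideal.span {(p : ℤ_[p]) ^ 4}] :=
    fun a b => by rw [SModEq.sub_mem, Ideal.mem_span_singleton]
  have ht := (hc _ _).1 hn
  have hG : ∀ y : ℤ_[p], padicGamma p (x + y * t) ≡ padicGamma p (x + y * n)
      [SMOD Ideal.span {(p : ℤ_[p]) ^ 4}] := by
    intro y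
    refine (hc _ _).1 (pow_dvd_padicGamma_sub hp2 (by norm_num) ?_)
    rw [show x + y * t - (x + y * n) = y * (t - n) by ring]
    exact Dvd.dvd.mul_left hn y
  rw [hc] at hnat ⊢
  have hl := (SModEq.refl (U := Ideal.span {(p : ℤ_[p]) ^ 4}) (padicGamma p x)).mul (hG (2 * p))
  refine hl.trans (hnat.trans ?_)
  refine SModEq.mul ((hG p).symm.pow 2) ?_
  refine ((SModEq.refl _).add ((SModEq.refl _).mul (ht.symm.pow 2))).add ((SModEq.refl _).mul ?_)
  exact (ht.symm.pow 2).mul (((SModEq.refl _).mul ht.symm).sub (SModEq.refl _))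

end PowerSums

/-! ### Rearrangements of finite sums -/

section Rearrangement

variable {R M : Type*} [CommRing R] [AddCommGroup M]

theorem sum_range_cast_reflect (f : R → M) (N : ℕ) :
    ∑ i ∈ Finset.range N, f ((i : R) + 1) =
      ∑ i ∈ Finset.range N, f ((N : R) + 1 - ((i : R) + 1)) := by
  rw [← Finset.sum_range_reflect (fun i => f ((i : R) + 1))]
  refine Finset.sum_congr rfl fun i hi => ?_
  have hi' := Finset.mem_range.1 hi
  rw [Nat.sub_sub, Nat.cast_sub (by omega)]
  congr 1
  push_cast
  ring

theorem sum_range_two_mul_fold (f : R → M) (m : ℕ) :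
    ∑ i ∈ Finset.range (2 * m), f ((i : R) + 1) =
      ∑ i ∈ Finset.range m, f ((i : R) + 1) +
      ∑ i ∈ Finset.range m, f (2 * m + 1 - ((i : R) + 1)) := by
  rw [two_mul, Finset.sum_range_add]
  have h := sum_range_cast_reflect (fun z : R => f (m + z)) m
  congr 1
  convert h using 3 <;> push_cast <;> ring

/-- Odd indices are written `2m + 1 - 2i` so that they become `p - 2i` when `p = 2m + 1`. -/
theorem sum_range_two_mul_parity (f : R → M) (m : ℕ) :
    ∑ i ∈ Finset.range (2 * m), f ((i : R) + 1) =
      ∑ i ∈ Finset.range m, f (2 * ((i : R) + 1)) +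
      ∑ i ∈ Finset.range m, f (2 * m + 1 - 2 * ((i : R) + 1)) := by
  have h := sum_range_cast_reflect (fun z : R => f (2 * z - 1)) m
  have h2 : ∑ i ∈ Finset.range m, f (2 * m + 1 - 2 * ((i : R) + 1)) =
      ∑ i ∈ Finset.range m, f (2 * ((i : R) + 1) - 1) := by
    rw [h]
    refine Finset.sum_congr rfl fun i _ => ?_
    congr 1
    ring
  rw [h2]
  clear h h2
  induction m with
  | zero => simp
  | succ m ih =>
    rw [show 2 * (m + 1) = 2 * m + 1 + 1 by ring]
    simp only [Finset.sum_range_succ, ih]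
    rw [show ((2 * m : ℕ) : R) + 1 = 2 * ((m : R) + 1) - 1 by push_cast; ring,
      show ((2 * m + 1 : ℕ) : R) + 1 = 2 * ((m : R) + 1) by push_cast; ring]
    abel

/-- Each shift of the window one place to the left gains a term at the left end and loses one at the
right. -/
theorem sum_range_neg_add (f : R → M) (N n : ℕ) :
    ∑ j ∈ Finset.range (N + 1), f (-(n : R) + (j : R)) =
      f 0 + ∑ i ∈ Finset.range N, f ((i : R) + 1) +
      ∑ i ∈ Finset.range n, (f (-((i : R) + 1)) - f ((N : R) + 1 - ((i : R) + 1))) := by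
  induction n with
  | zero =>
    rw [Finset.sum_range_succ']
    simp [add_comm]
  | succ n ih =>
    rw [Finset.sum_range_succ _ n, ← add_assoc, ← ih]
    have h1 := Finset.sum_range_succ (fun j : ℕ => f (-((n : R) + 1) + (j : R))) (N + 1)
    rw [Finset.sum_range_succ'] at h1
    have h2 : ∑ j ∈ Finset.range (N + 1), f (-((n : R) + 1) + ((j + 1 : ℕ) : R)) =
        ∑ j ∈ Finset.range (N + 1), f (-(n : R) + (j : R)) := by
      refine Finset.sum_congr rfl fun j _ => ?_
      congr 1
      push_cast
      ring
    rw [h2, show -((n : R) + 1) + ((N + 1 : ℕ) : R) = (N : R) + 1 - ((n : R) + 1) by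
      push_cast; ring, Nat.cast_zero, add_zero] at h1
    rw [Nat.cast_succ, ← add_sub_assoc, h1]
    abel

end Rearrangement

/-! ### Harmonic sums in `ℤ_[p]` -/

section Harmonic

variable {p : ℕ} [Fact p.Prime]

theorem PadicInt.eq_inv_of_mul_eq_one {a b : ℤ_[p]} (h : a * b = 1) : a = b.inv := by
  have hb := inv_mul_of_isUnit (IsUnit.of_mul_eq_one a (by rwa [mul_comm]))
  linear_combination b.inv * h - a * hb

theorem PadicInt.inv_neg' (z : ℤ_[p]) : (-z).inv = -z.inv := by
  by_cases hz : IsUnit z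
  · refine (eq_inv_of_mul_eq_one ?_).symm
    linear_combination inv_mul_of_isUnit hz
  · rw [inv_of_not_isUnit hz, inv_of_not_isUnit (fun h => hz (neg_neg z ▸ h.neg)), neg_zero]

theorem PadicInt.inv_mul_distrib (a b : ℤ_[p]) : (a * b).inv = a.inv * b.inv := by
  by_cases ha : IsUnit a
  · by_cases hb : IsUnit b
    · refine (eq_inv_of_mul_eq_one ?_).symm
      linear_combination inv_mul_of_isUnit ha * (b.inv * b) + inv_mul_of_isUnit hb
    · rw [inv_of_not_isUnit hb, inv_of_not_isUnit (fun h => hb (isUnit_of_mul_isUnit_right h)),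
        mul_zero]
  · rw [inv_of_not_isUnit ha, inv_of_not_isUnit (fun h => ha (isUnit_of_mul_isUnit_left h)),
      zero_mul]

/-- Substituting this identity into itself yields the geometric expansion of `1 / (p - z)`; at
non-units both sides are `0`. -/
theorem PadicInt.inv_prime_sub (z : ℤ_[p]) :
    ((p : ℤ_[p]) - z).inv = p * z.inv * ((p : ℤ_[p]) - z).inv - z.inv := by
  have hiff : IsUnit ((p : ℤ_[p]) - z) ↔ IsUnit z := by
    rw [sub_eq_add_neg, add_comm, isUnit_add_iff (dvd_refl _), IsUnit.neg_iff]
  by_cases hz : IsUnit z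
  · have h1 := inv_mul_of_isUnit hz
    have h2 := inv_mul_of_isUnit (hiff.2 hz)
    linear_combination (-((p : ℤ_[p]) - z).inv) * h1 - z.inv * h2
  · rw [inv_of_not_isUnit hz, inv_of_not_isUnit (fun h => hz (hiff.1 h))]
    ring

theorem PadicInt.inv_prime_sub_congr (z : ℤ_[p]) :
    (p : ℤ_[p]) ^ 3 ∣ ((p : ℤ_[p]) - z).inv + (z.inv + p * z.inv ^ 2 + p ^ 2 * z.inv ^ 3) := by
  have h := inv_prime_sub z
  refine ⟨z.inv ^ 3 * ((p : ℤ_[p]) - z).inv, ?_⟩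
  linear_combination (1 + p * z.inv + p ^ 2 * z.inv ^ 2) * h

theorem PadicInt.inv_prime_sub_sq_congr (z : ℤ_[p]) :
    (p : ℤ_[p]) ^ 2 ∣ ((p : ℤ_[p]) - z).inv ^ 2 - (z.inv ^ 2 + 2 * p * z.inv ^ 3) := by
  obtain ⟨r, hr⟩ := inv_prime_sub_congr z
  have h : ((p : ℤ_[p]) - z).inv = -z.inv - p * z.inv ^ 2 + p ^ 2 * (p * r - z.inv ^ 3) := by
    linear_combination hr
  rw [h]
  exact ⟨z.inv ^ 4 - 2 * (z.inv + p * z.inv ^ 2) * (p * r - z.inv ^ 3) +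
    p ^ 2 * (p * r - z.inv ^ 3) ^ 2, by ring⟩

theorem PadicInt.inv_prime_sub_cube_congr (z : ℤ_[p]) :
    (p : ℤ_[p]) ∣ ((p : ℤ_[p]) - z).inv ^ 3 + z.inv ^ 3 := by
  have h := inv_prime_sub z
  have h2 : ((p : ℤ_[p]) - z).inv + z.inv = p * (z.inv * ((p : ℤ_[p]) - z).inv) := by
    linear_combination h
  refine Dvd.dvd.trans ⟨_, h2⟩ ⟨((p : ℤ_[p]) - z).inv ^ 2 - ((p : ℤ_[p]) - z).inv * z.inv
    + z.inv ^ 2, by ring⟩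

variable (p) in
/-- The harmonic sum `∑ 1 / i ^ k` over `1 ≤ i ≤ m`, `p ∤ i`, as a `p`-adic integer. -/
noncomputable def harmonicInt (k m : ℕ) : ℤ_[p] :=
  ∑ i ∈ Finset.range m, ((i : ℤ_[p]) + 1).inv ^ k

theorem cast_sub_one_add_one : ((p - 1 : ℕ) : ℤ_[p]) + 1 = p := by
  have h : p - 1 + 1 = p := Nat.sub_add_cancel (Fact.out : p.Prime).one_le
  exact_mod_cast congrArg (Nat.cast (R := ℤ_[p])) h

theorem invPowerSum_neg_natCast (n : ℕ) {k : ℕ} (hk : k ≠ 0) :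
    invPowerSum (-(n : ℤ_[p])) k = harmonicInt p k (p - 1) +
      ∑ i ∈ Finset.range n, ((-((i : ℤ_[p]) + 1)).inv ^ k -
        ((p : ℤ_[p]) - ((i : ℤ_[p]) + 1)).inv ^ k) := by
  have h := sum_range_neg_add (fun z : ℤ_[p] => z.inv ^ k) (p - 1) n
  rw [cast_sub_one_add_one, Nat.sub_add_cancel (Fact.out : p.Prime).one_le,
    inv_of_not_isUnit not_isUnit_zero, zero_pow hk, zero_add] at h
  exact h

theorem invPowerSum_one_neg_congr (n : ℕ) :
    (p : ℤ_[p]) ^ 3 ∣ invPowerSum (-(n : ℤ_[p])) 1 -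
      (harmonicInt p 1 (p - 1) + p * harmonicInt p 2 n + p ^ 2 * harmonicInt p 3 n) := by
  rw [invPowerSum_neg_natCast n one_ne_zero]
  unfold harmonicInt
  rw [Finset.mul_sum, Finset.mul_sum, add_assoc, add_sub_add_left_eq_sub,
    ← Finset.sum_add_distrib, ← Finset.sum_sub_distrib]
  refine Finset.dvd_sum fun i _ => ?_
  have h := inv_prime_sub_congr ((i : ℤ_[p]) + 1)
  rw [← dvd_neg, PadicInt.inv_neg']
  convert h using 1
  ring

theorem invPowerSum_two_neg_congr (n : ℕ) :
    (p : ℤ_[p]) ^ 2 ∣ invPowerSum (-(n : ℤ_[p])) 2 -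
      (harmonicInt p 2 (p - 1) - 2 * p * harmonicInt p 3 n) := by
  rw [invPowerSum_neg_natCast n two_ne_zero]
  unfold harmonicInt
  rw [Finset.mul_sum, sub_eq_add_neg (∑ i ∈ Finset.range (p - 1), _), add_sub_add_left_eq_sub,
    ← Finset.sum_neg_distrib, ← Finset.sum_sub_distrib]
  refine Finset.dvd_sum fun i _ => ?_
  have h := inv_prime_sub_sq_congr ((i : ℤ_[p]) + 1)
  rw [← dvd_neg, PadicInt.inv_neg']
  convert h using 1
  ring

/-- Pair `i` with `p - i`, as in Wolstenholme's theorem. -/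
theorem two_mul_harmonicInt_one_congr :
    (p : ℤ_[p]) ^ 3 ∣ 2 * harmonicInt p 1 (p - 1) +
      (p * harmonicInt p 2 (p - 1) + p ^ 2 * harmonicInt p 3 (p - 1)) := by
  have h := sum_range_cast_reflect (fun z : ℤ_[p] => z.inv ^ 1) (p - 1)
  rw [cast_sub_one_add_one] at h
  rw [two_mul]
  nth_rewrite 2 [harmonicInt]
  rw [h]
  unfold harmonicInt
  rw [Finset.mul_sum, Finset.mul_sum, ← Finset.sum_add_distrib, ← Finset.sum_add_distrib,
    ← Finset.sum_add_distrib]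
  refine Finset.dvd_sum fun i _ => ?_
  convert inv_prime_sub_congr ((i : ℤ_[p]) + 1) using 1
  ring

theorem prime_dvd_harmonicInt_three (hp : 5 < p) : (p : ℤ_[p]) ∣ harmonicInt p 3 (p - 1) := by
  have h := prime_dvd_invPowerSum (-((0 : ℕ) : ℤ_[p])) (k := 3) (by omega)
  rwa [invPowerSum_neg_natCast 0 (by norm_num), Finset.sum_range_zero, add_zero] at h

theorem harmonicInt_two_fold_congr {m : ℕ} (hm : p = 2 * m + 1) :
    (p : ℤ_[p]) ^ 2 ∣ harmonicInt p 2 (p - 1) - (2 * harmonicInt p 2 m + 2 * p * harmonicInt p 3 m)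
    := by
  have hm' : (2 : ℤ_[p]) * m + 1 = p := by exact_mod_cast congrArg (Nat.cast (R := ℤ_[p])) hm.symm
  have h := sum_range_two_mul_fold (fun z : ℤ_[p] => z.inv ^ 2) m
  rw [hm', show 2 * m = p - 1 by omega] at h
  rw [show harmonicInt p 2 (p - 1) = _ from h]
  unfold harmonicInt
  simp only [Finset.mul_sum, ← Finset.sum_add_distrib, ← Finset.sum_sub_distrib]
  refine Finset.dvd_sum fun i _ => ?_
  convert inv_prime_sub_sq_congr ((i : ℤ_[p]) + 1) using 1
  ring

theorem harmonicInt_two_parity_congr (hp : 5 < p) {m : ℕ} (hm : p = 2 * m + 1) :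
    (p : ℤ_[p]) ^ 2 ∣ 4 * harmonicInt p 2 (p - 1) - (2 * harmonicInt p 2 m + p * harmonicInt p 3 m)
    := by
  have hm' : (2 : ℤ_[p]) * m + 1 = p := by exact_mod_cast congrArg (Nat.cast (R := ℤ_[p])) hm.symm
  have h := sum_range_two_mul_parity (fun z : ℤ_[p] => z.inv ^ 2) m
  rw [hm', show 2 * m = p - 1 by omega] at h
  rw [show harmonicInt p 2 (p - 1) = _ from h]
  unfold harmonicInt
  simp only [Finset.mul_sum, ← Finset.sum_add_distrib, ← Finset.sum_sub_distrib]
  refine Finset.dvd_sum fun i _ => ?_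
  obtain ⟨r, hr⟩ := inv_prime_sub_sq_congr (2 * ((i : ℤ_[p]) + 1))
  rw [PadicInt.inv_mul_distrib] at hr ⊢
  have h2 := inv_mul_of_isUnit (isUnit_two hp)
  set u := ((i : ℤ_[p]) + 1).inv
  set w := (2 : ℤ_[p]).inv
  refine ⟨4 * r, ?_⟩
  linear_combination 4 * hr + (2 * u ^ 2 * (2 * w + 1) + p * u ^ 3 * (4 * w ^ 2 + 2 * w + 1)) * h2

/-- Split `1, …, 2n` by parity. The even terms give `H₃(n) / 8`; the odd ones are `p - 2j` with `n <
j ≤ 2n` and give `-(H₃(2n) - H₃(n)) / 8` modulo `p`. -/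
theorem harmonicInt_three_quarter_congr (hp : 5 < p) {n : ℕ} (hn : p = 4 * n + 1) :
    (p : ℤ_[p]) ∣ 2 * harmonicInt p 3 n - 9 * harmonicInt p 3 (2 * n) := by
  have hn' : (p : ℤ_[p]) = 4 * n + 1 := by exact_mod_cast congrArg (Nat.cast (R := ℤ_[p])) hn
  have h2 := inv_mul_of_isUnit (isUnit_two hp)
  have hodd : (p : ℤ_[p]) ∣ 8 * ∑ i ∈ Finset.range n, (2 * (n : ℤ_[p]) + 1 -
      2 * ((i : ℤ_[p]) + 1)).inv ^ 3 + (harmonicInt p 3 (2 * n) - harmonicInt p 3 n) := by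
    have h1 : harmonicInt p 3 (2 * n) - harmonicInt p 3 n =
        ∑ i ∈ Finset.range n, ((n : ℤ_[p]) + (i : ℤ_[p]) + 1).inv ^ 3 := by
      unfold harmonicInt
      rw [two_mul, Finset.sum_range_add, add_sub_cancel_left]
      simp
    rw [h1, Finset.mul_sum, ← Finset.sum_add_distrib]
    refine Finset.dvd_sum fun i _ => ?_
    obtain ⟨r, hr⟩ := inv_prime_sub_cube_congr (2 * ((n : ℤ_[p]) + (i : ℤ_[p]) + 1))
    rw [PadicInt.inv_mul_distrib, show (p : ℤ_[p]) - 2 * ((n : ℤ_[p]) + (i : ℤ_[p]) + 1) =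
      2 * (n : ℤ_[p]) + 1 - 2 * ((i : ℤ_[p]) + 1) by rw [hn']; ring] at hr
    set u := ((n : ℤ_[p]) + (i : ℤ_[p]) + 1).inv
    set w := (2 : ℤ_[p]).inv
    refine ⟨8 * r, ?_⟩
    linear_combination 8 * hr - u ^ 3 * (4 * w ^ 2 + 2 * w + 1) * h2
  have heven : 8 * ∑ i ∈ Finset.range n, (2 * ((i : ℤ_[p]) + 1)).inv ^ 3 = harmonicInt p 3 n := by
    unfold harmonicInt
    rw [Finset.mul_sum]
    refine Finset.sum_congr rfl fun i _ => ?_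
    rw [PadicInt.inv_mul_distrib]
    set u := ((i : ℤ_[p]) + 1).inv
    set w := (2 : ℤ_[p]).inv
    linear_combination u ^ 3 * (4 * w ^ 2 + 2 * w + 1) * h2
  have h := sum_range_two_mul_parity (fun z : ℤ_[p] => z.inv ^ 3) n
  obtain ⟨r, hr⟩ := hodd
  refine ⟨-r, ?_⟩
  have h' : harmonicInt p 3 (2 * n) = _ := h
  linear_combination -hr - 8 * h' - heven

/-- The power sums at `-n`, for `p = 4 n + 1`, in terms of harmonic numbers of order two. -/
theorem invPowerSum_quarter_congr (hp : 5 < p) {n : ℕ} (hn : p = 4 * n + 1) :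
    (p : ℤ_[p]) ^ 3 ∣ 4 * invPowerSum (-(n : ℤ_[p])) 1 + p * invPowerSum (-(n : ℤ_[p])) 2 +
      8 * p * harmonicInt p 2 (2 * n) - 4 * p * harmonicInt p 2 n := by
  obtain ⟨a, ha⟩ := invPowerSum_one_neg_congr (p := p) n
  obtain ⟨b, hb⟩ := invPowerSum_two_neg_congr (p := p) n
  obtain ⟨c, hc⟩ := two_mul_harmonicInt_one_congr (p := p)
  obtain ⟨d, hd⟩ := prime_dvd_harmonicInt_three hp
  obtain ⟨e, he⟩ := harmonicInt_two_fold_congr (p := p) (m := 2 * n) (by omega)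
  obtain ⟨f, hf⟩ := harmonicInt_two_parity_congr hp (m := 2 * n) (by omega)
  obtain ⟨g, hg⟩ := harmonicInt_three_quarter_congr hp hn
  -- Five times the fold congruence minus the parity one gives `H₂(p - 1) ≡ 8 H₂(2n) + 9 p H₃(2n)`;
  -- exactly this multiple of `H₃(2n)` cancels against `2 p H₃(n)`.
  refine ⟨4 * a + b + 2 * c - 2 * d - 5 * e + f + g, ?_⟩
  linear_combination 4 * ha + p * hb + 2 * hc - 2 * p ^ 2 * hd - 5 * p * he + p * hf + p ^ 2 * hg

end Harmonic

/-! ### Shifted factorials and harmonic numbers as `p`-adic integers -/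

theorem shiftedFactorial_eq_prod (x : ℚ) (n : ℕ) :
    shiftedFactorial x n = ∏ k ∈ Finset.range n, (x + k) := by
  unfold shiftedFactorial
  induction n with
  | zero => simp
  | succ n ih => rw [ascPochhammer_succ_eval, ih, Finset.prod_range_succ]

section Main

variable {p : ℕ} [Fact p.Prime]

theorem PadicInt.coe_inv_of_isUnit {z : ℤ_[p]} (hz : IsUnit z) :
    ((z.inv : ℤ_[p]) : ℚ_[p]) = (z : ℚ_[p])⁻¹ := by
  refine eq_inv_of_mul_eq_one_left ?_
  rw [← PadicInt.coe_mul, inv_mul_of_isUnit hz, PadicInt.coe_one]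

theorem PadicInt.coe_ofNat_eq (n : ℕ) [n.AtLeastTwo] :
    ((OfNat.ofNat n : ℤ_[p]) : ℚ_[p]) = OfNat.ofNat n := rfl

theorem coe_prod_add_natCast (x : ℤ_[p]) (n : ℕ) :
    ((∏ k ∈ Finset.range n, (x + (k : ℤ_[p])) : ℤ_[p]) : ℚ_[p]) =
      ∏ k ∈ Finset.range n, ((x : ℚ_[p]) + (k : ℚ_[p])) := by
  exact map_prod PadicInt.Coe.ringHom _ _

theorem cast_shiftedFactorial {x : ℚ} {z : ℤ_[p]} (h : (x : ℚ_[p]) = z) (n : ℕ) :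
    ((shiftedFactorial x n : ℚ) : ℚ_[p]) =
      ((∏ k ∈ Finset.range n, (z + (k : ℤ_[p])) : ℤ_[p]) : ℚ_[p]) := by
  rw [shiftedFactorial_eq_prod, coe_prod_add_natCast, ← h]
  push_cast
  rfl

theorem cast_harmonicOrder {m : ℕ} (hm : m < p) (k : ℕ) :
    ((harmonicOrder k m : ℚ) : ℚ_[p]) = (harmonicInt p k m : ℚ_[p]) := by
  induction m with
  | zero => simp [harmonicOrder, harmonicInt]
  | succ m ih =>
    have ih' := ih (by omega)
    unfold harmonicOrder harmonicInt at ih' ⊢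
    have hu : IsUnit (((m + 1 : ℕ) : ℤ_[p])) :=
      isUnit_natCast_iff.2 fun h => absurd (Nat.le_of_dvd (by omega) h) (by omega)
    rw [Finset.sum_Icc_succ_top (by omega), Finset.sum_range_succ, Rat.cast_add, ih',
      PadicInt.coe_add, PadicInt.coe_pow, ← Nat.cast_succ, Nat.succ_eq_add_one,
      coe_inv_of_isUnit hu]
    simp

/-- `Γ_p(x + m)` in terms of `Γ_p(x)` when no factor of `(x)_m` is divisible by `p`. -/
theorem padicGamma_add_natCast_of_isUnit (hp2 : p ≠ 2) (x : ℤ_[p]) (m : ℕ)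
    (h : ∀ k < m, IsUnit (x + (k : ℤ_[p]))) :
    padicGamma p (x + m) = padicGamma p x * ((-1) ^ m * ∏ k ∈ Finset.range m, (x + (k : ℤ_[p]))) := by
  rw [padicGamma_add_natCast hp2, ← Finset.card_range m, ← Finset.prod_const, Finset.card_range,
    ← Finset.prod_mul_distrib]
  congr 1
  refine Finset.prod_congr rfl fun k hk => ?_
  rw [padicGammaStep_of_isUnit (h k (Finset.mem_range.1 hk)), neg_one_mul]

/-- `Γ_p(x + m)` in terms of `Γ_p(x)` when exactly one factor of `(x)_m` is divisible by `p`. -/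
theorem padicGamma_add_natCast_mul (hp2 : p ≠ 2) (x : ℤ_[p]) {m r : ℕ} (hr : r < m)
    (h : ∀ k < m, IsUnit (x + (k : ℤ_[p])) ↔ k ≠ r) :
    padicGamma p (x + m) * (x + (r : ℤ_[p])) =
      padicGamma p x * ((-1) ^ m * ∏ k ∈ Finset.range m, (x + (k : ℤ_[p]))) := by
  have h1 : ∏ k ∈ Finset.range m, (if k = r then x + (r : ℤ_[p]) else 1) = x + (r : ℤ_[p]) := by
    rw [Finset.prod_ite_eq' (Finset.range m) r (fun _ => x + (r : ℤ_[p])),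
      if_pos (Finset.mem_range.2 hr)]
  rw [← h1]
  rw [padicGamma_add_natCast hp2, ← Finset.card_range m, ← Finset.prod_const, Finset.card_range,
    ← Finset.prod_mul_distrib, mul_assoc, ← Finset.prod_mul_distrib]
  congr 1
  refine Finset.prod_congr rfl fun k hk => ?_
  have hk' := h k (Finset.mem_range.1 hk)
  by_cases hkr : k = r
  · rw [padicGammaStep_of_not_isUnit (fun hu => hk'.1 hu hkr), if_pos hkr, hkr]
  · rw [padicGammaStep_of_isUnit (hk'.2 hkr), if_neg hkr]
    ring

/-- Clearing the denominator of `x = b / a` reduces the question to divisibility in `ℕ`. -/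
theorem isUnit_add_natCast_iff {x : ℤ_[p]} {a b : ℕ} (ha : ¬ p ∣ a) (hx : (a : ℤ_[p]) * x = b)
    (k : ℕ) : IsUnit (x + (k : ℤ_[p])) ↔ ¬ p ∣ b + a * k := by
  rw [← isUnit_natCast_iff (p := p)]
  have h : ((b + a * k : ℕ) : ℤ_[p]) = a * (x + k) := by
    push_cast
    linear_combination -hx
  rw [h, IsUnit.mul_iff]
  exact (and_iff_right (isUnit_natCast_iff.2 ha)).symm

/-! ### The case `p ≡ 1 (mod 4)` -/

theorem prod_half_sq_eq (hp : 5 < p) {n : ℕ} (hn : p = 4 * n + 1) {q : ℤ_[p]} (hq : 4 * q = 1) :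
    (∏ k ∈ Finset.range n, (2 * q + (k : ℤ_[p]))) ^ 2 = (n.factorial : ℤ_[p]) ^ 2 *
      -(padicGamma p (-n) * padicGamma p (-n + 2 * p * q)) ^ 2 := by
  have hp2 : p ≠ 2 := by omega
  have hn' : (p : ℤ_[p]) = 4 * n + 1 := by exact_mod_cast congrArg (Nat.cast (R := ℤ_[p])) hn
  have hnd2 : ¬ p ∣ 2 := fun h => absurd (Nat.le_of_dvd (by norm_num) h) (by omega)
  have h1 := padicGamma_add_natCast_of_isUnit hp2 (2 * q) n fun k hk => by
    rw [isUnit_add_natCast_iff (a := 2) (b := 1) hnd2 (by push_cast; linear_combination hq)]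
    exact fun h => absurd (Nat.le_of_dvd (by omega) h) (by omega)
  have h2 := padicGamma_add_natCast_of_isUnit hp2 1 n fun k hk => by
    have : ((k + 1 : ℕ) : ℤ_[p]) = 1 + k := by push_cast; ring
    rw [← this, isUnit_natCast_iff]
    exact fun h => absurd (Nat.le_of_dvd (by omega) h) (by omega)
  have hfac : ∏ k ∈ Finset.range n, (1 + (k : ℤ_[p])) = n.factorial := by
    rw [← Finset.prod_range_add_one_eq_factorial]
    push_cast
    exact Finset.prod_congr rfl fun k _ => add_comm _ _
  rw [hfac, padicGamma_one hp2] at h2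
  have h3 : padicGamma p (2 * q) * padicGamma p (1 - 2 * q) = (-1) ^ (2 * n + 1) := by
    refine padicGamma_reflection hp2 (by omega) (by omega) ?_
    refine (isUnit_two hp).dvd_mul_left.1 ⟨-1, ?_⟩
    push_cast
    linear_combination hq + hn'
  rw [show 1 - 2 * q = 2 * q by linear_combination -hq, pow_succ, pow_mul] at h3
  have h4 := padicGamma_reflection_sq hp2 (-(n : ℤ_[p]))
  rw [show (1 : ℤ_[p]) - -n = 1 + n by ring] at h4
  -- The far end of the progression is `n + 1/2`, because `p = 4n + 1`.
  rw [show -(n : ℤ_[p]) + 2 * p * q = 2 * q + n by linear_combination 2 * q * hn' + 2 * n * hq]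
  have hs : ((-1 : ℤ_[p]) ^ n) ^ 2 = 1 := by rw [← pow_mul, mul_comm, pow_mul]; norm_num
  norm_num at h3
  set P := ∏ k ∈ Finset.range n, (2 * q + (k : ℤ_[p]))
  set s := (-1 : ℤ_[p]) ^ n
  set F := (n.factorial : ℤ_[p])
  set G := padicGamma p (2 * q)
  set H := padicGamma p (-(n : ℤ_[p]))
  rw [h2] at h4
  rw [h1]
  have h5 : F ^ 2 * H ^ 2 = 1 := by linear_combination h4 - H ^ 2 * F ^ 2 * hs
  linear_combination (-P ^ 2) * h5 + (F ^ 2 * H ^ 2 * s ^ 2 * P ^ 2) * h3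
    - (F ^ 2 * H ^ 2 * P ^ 2) * hs

theorem padicGamma_quarter_pow_four_congr (hp : 5 < p) {n : ℕ} (hn : p = 4 * n + 1) {q : ℤ_[p]}
    (hq : 4 * q = 1) :
    (p : ℤ_[p]) ^ 4 ∣ (padicGamma p (-n) * padicGamma p (-n + 2 * p * q)) ^ 2 *
      (1 + p ^ 2 * q * harmonicInt p 2 (2 * n) - 2 * p ^ 2 * q ^ 2 * harmonicInt p 2 n) -
      padicGamma p q ^ 4 := by
  have hn' : (p : ℤ_[p]) = 4 * n + 1 := by exact_mod_cast congrArg (Nat.cast (R := ℤ_[p])) hn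
  obtain ⟨c, hc, r, hr⟩ := padicGamma_second_difference hp (-(n : ℤ_[p])) q
  obtain ⟨d, hd⟩ := invPowerSum_quarter_congr hp hn
  obtain ⟨a, ha⟩ := prime_dvd_invPowerSum (-(n : ℤ_[p])) (k := 1) (by omega)
  rw [show -(n : ℤ_[p]) + p * q = q by linear_combination q * hn' + n * hq] at hr
  rw [ha] at hc hd hr
  set P₂ := invPowerSum (-(n : ℤ_[p])) 2
  set h₂ := harmonicInt p 2 (2 * n)
  set g₂ := harmonicInt p 2 n
  set G := padicGamma p q
  set X := padicGamma p (-n) * padicGamma p (-n + 2 * p * q)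
  set E := a * q ^ 2 + p * c * (q ^ 2 * (2 * q - 1)) with hE
  have hX : X = G ^ 2 * (1 + p ^ 2 * E) + p ^ 4 * r := by
    simp only [hE]
    linear_combination hr
  -- At `t = 1/4` one has `2t - 1 = -1/2`, so `2 p E` is `q² / 2` times `4 S₁ + p S₂` modulo `p³`,
  -- where `Sₖ` is the `k`-th power sum at `-n`. This is the combination in `hd`.
  have hEW : ∃ v : ℤ_[p], p ^ 2 * (2 * E + q * h₂ - 2 * q ^ 2 * g₂) = p ^ 4 * v := by
    refine ⟨2 * q ^ 3 * (d - a ^ 2), ?_⟩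
    simp only [hE]
    linear_combination 2 * q ^ 3 * p * hd - 2 * q ^ 3 * p ^ 2 * hc +
      (-2 * q ^ 2 * p ^ 2 * a + 2 * q ^ 2 * p ^ 3 * c - p ^ 2 * h₂ * q * (4 * q + 1) +
        2 * q ^ 2 * p ^ 2 * g₂) * hq
  obtain ⟨v, hv⟩ := hEW
  rw [hX]
  refine ⟨G ^ 4 * (v + E ^ 2 + (2 * E + p ^ 2 * E ^ 2) * (q * h₂ - 2 * q ^ 2 * g₂)) +
    (2 * G ^ 2 * (1 + p ^ 2 * E) * r + p ^ 4 * r ^ 2) *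
      (1 + p ^ 2 * q * h₂ - 2 * p ^ 2 * q ^ 2 * g₂), ?_⟩
  linear_combination G ^ 4 * hv

/-! ### The case `p ≡ 3 (mod 4)` -/

theorem prod_three_quarters_eq (hp : 5 < p) {r : ℕ} (hr : p = 4 * r + 3) {q : ℤ_[p]}
    (hq : 4 * q = 1) :
    ∏ k ∈ Finset.range (2 * r + 1), (3 * q + (k : ℤ_[p])) =
      (∏ k ∈ Finset.range (2 * r + 1), (5 * q + (k : ℤ_[p]))) *
      -(p * q ^ 2 * padicGamma p q ^ 2 *
        (padicGamma p (q - 2 * p * q) * padicGamma p (q + 2 * p * q))) ∧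
    IsUnit (∏ k ∈ Finset.range (2 * r + 1), (5 * q + (k : ℤ_[p]))) := by
  have hp2 : p ≠ 2 := by omega
  have hr' : (p : ℤ_[p]) = 4 * r + 3 := by exact_mod_cast congrArg (Nat.cast (R := ℤ_[p])) hr
  have hnd : ¬ p ∣ 4 := fun h => absurd (Nat.le_of_dvd (by norm_num) h) (by omega)
  have hu3 : ∀ k < 2 * r + 1, IsUnit (3 * q + (k : ℤ_[p])) ↔ k ≠ r := by
    intro k hk
    rw [isUnit_add_natCast_iff (a := 4) (b := 3) hnd (by push_cast; linear_combination 3 * hq)]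
    refine not_congr ⟨?_, ?_⟩
    · rintro ⟨c, hc⟩
      -- `3 + 4k ≤ 8r + 3 < 2p`, so the only possible multiple of `p` is `p` itself, at `k = r`.
      have hc2 : c < 2 := by
        by_contra! hcc
        have := Nat.mul_le_mul_left p hcc
        omega
      interval_cases c <;> omega
    · rintro rfl
      exact ⟨1, by omega⟩
  have hu5 : ∀ k < 2 * r + 1, IsUnit (5 * q + (k : ℤ_[p])) := by
    intro k hk
    rw [isUnit_add_natCast_iff (a := 4) (b := 5) hnd (by push_cast; linear_combination 5 * hq)]
    rintro ⟨c, hc⟩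
    have hc2 : c < 2 := by
      by_contra! hcc
      have := Nat.mul_le_mul_left p hcc
      omega
    interval_cases c <;> omega
  have h3 := padicGamma_add_natCast_mul hp2 (3 * q) (by omega) hu3
  have h5 := padicGamma_add_natCast_of_isUnit hp2 (5 * q) (2 * r + 1) hu5
  have hmq : ((2 * r + 1 : ℕ) : ℤ_[p]) = 2 * p * q - 2 * q := by
    push_cast
    linear_combination (-2 * q) * hr' - (2 * r + 1) * hq
  have hG5 : padicGamma p (5 * q) = -q * padicGamma p q := by
    have h := padicGamma_add_one hp2 q
    rwa [padicGammaStep_of_isUnit (IsUnit.of_mul_eq_one 4 (by rwa [mul_comm])),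
      show q + 1 = 5 * q by linear_combination -hq] at h
  rw [hmq, show 3 * q + (2 * p * q - 2 * q) = q + 2 * p * q by ring,
    show 3 * q + (r : ℤ_[p]) = p * q by linear_combination (-q) * hr' - r * hq,
    show 3 * q = 1 - q by linear_combination hq] at h3
  rw [hmq, hG5, show 5 * q + (2 * p * q - 2 * q) = 1 - (q - 2 * p * q) by
    linear_combination hq] at h5
  have hR1 := padicGamma_reflection_sq hp2 q
  have hR2 : padicGamma p q * padicGamma p (1 - q) = padicGamma p (q - 2 * p * q) *
      padicGamma p (1 - (q - 2 * p * q)) :=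
    padicGamma_reflection_congr hp2 ⟨2 * q, by ring⟩
  have hs : ((-1 : ℤ_[p]) ^ (2 * r + 1)) ^ 2 = 1 := by rw [← pow_mul, mul_comm, pow_mul]; norm_num
  refine ⟨?_, ?_⟩
  · rw [show 1 - q = 3 * q by linear_combination -hq] at h3 hR1 hR2
    set A := ∏ k ∈ Finset.range (2 * r + 1), (3 * q + (k : ℤ_[p]))
    set B := ∏ k ∈ Finset.range (2 * r + 1), (5 * q + (k : ℤ_[p]))
    set s := (-1 : ℤ_[p]) ^ (2 * r + 1)
    set G := padicGamma p q
    set K := padicGamma p (3 * q)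
    set X := padicGamma p (q - 2 * p * q)
    set Y := padicGamma p (q + 2 * p * q)
    set Z := padicGamma p (1 - (q - 2 * p * q))
    linear_combination (-A) * hR1 - A * (G * K) ^ 2 * hs - s * G ^ 2 * K * h3 +
      Y * p * q * s * G * hR2 + Y * p * q * s * G * X * h5 - Y * p * q ^ 2 * G ^ 2 * X * B * hs
  · have h := isUnit_padicGamma hp2 (1 - (q - 2 * p * q))
    rw [h5] at h
    exact isUnit_of_mul_isUnit_right (isUnit_of_mul_isUnit_right h)

/-- Starting at `q - 2pq` with `t = 2q` centres the progression at `q`; the correction is `O(p ^ 2)`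
because `p` divides the first power sum. -/
theorem padicGamma_second_difference_sq_congr (hp : 5 < p) (q : ℤ_[p]) :
    (p : ℤ_[p]) ^ 2 ∣ padicGamma p (q - 2 * p * q) * padicGamma p (q + 2 * p * q) -
      padicGamma p q ^ 2 := by
  obtain ⟨c, hc, r, hr⟩ := padicGamma_second_difference hp (q - 2 * p * q) (2 * q)
  obtain ⟨a, ha⟩ := prime_dvd_invPowerSum (q - 2 * (p : ℤ_[p]) * q) (k := 1) (by omega)
  rw [ha, show q - 2 * p * q + p * (2 * q) = q by ring,
    show q - 2 * p * q + 2 * p * (2 * q) = q + 2 * p * q by ring] at hr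
  refine ⟨p ^ 2 * r + padicGamma p q ^ 2 *
    (a * (2 * q) ^ 2 + p * c * ((2 * q) ^ 2 * (2 * (2 * q) - 1))), ?_⟩
  linear_combination hr

end Main

/-! ### Transfer to `ℚ_[p]` and conclusion. -/

theorem proposition1p7 (p : ℕ) [Fact p.Prime] (hp : 5 < p) :
    (p % 4 = 1 →
      PadicCongr p 4
        ((shiftedFactorial (1 / 2) ((p - 1) / 4) ^ 2 / (((p - 1) / 4).factorial : ℚ) ^ 2 *
          (1 + (p : ℚ) ^ 2 / 4 * harmonicOrder 2 ((p - 1) / 2)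
            - (p : ℚ) ^ 2 / 8 * harmonicOrder 2 ((p - 1) / 4)) : ℚ) : ℚ_[p])
        (-((padicGamma p (PadicInt.inv 4) : ℚ_[p]) ^ 4))) ∧
    (p % 4 = 3 →
      PadicCongr p 3
        ((shiftedFactorial (3 / 4) ((p - 1) / 2) / shiftedFactorial (5 / 4) ((p - 1) / 2) : ℚ) :
          ℚ_[p])
        (-((p : ℚ_[p]) / 16) * (padicGamma p (PadicInt.inv 4) : ℚ_[p]) ^ 4)) := by
  have hq : 4 * (PadicInt.inv 4 : ℤ_[p]) = 1 := by
    rw [mul_comm]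
    exact inv_mul_of_isUnit (isUnit_four hp)
  have hqc : ((PadicInt.inv 4 : ℤ_[p]) : ℚ_[p]) = 1 / 4 := by
    rw [coe_inv_of_isUnit (isUnit_four hp), one_div]
    rfl
  set q : ℤ_[p] := PadicInt.inv 4
  constructor
  · intro hmod
    obtain ⟨n, hn⟩ : ∃ n, p = 4 * n + 1 := ⟨p / 4, by omega⟩
    rw [show (p - 1) / 4 = n by omega, show (p - 1) / 2 = 2 * n by omega]
    obtain ⟨z, hz⟩ := padicGamma_quarter_pow_four_congr hp hn hq
    have hP := congrArg (fun a : ℤ_[p] => (a : ℚ_[p])) (prod_half_sq_eq hp hn hq)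
    have hz' := congrArg (fun a : ℤ_[p] => (a : ℚ_[p])) hz
    refine ⟨-z, ?_⟩
    have hF : (n.factorial : ℚ_[p]) ≠ 0 := by exact_mod_cast n.factorial_ne_zero
    push_cast at hP hz' ⊢
    rw [cast_shiftedFactorial (z := 2 * q) (by rw [PadicInt.coe_mul, coe_ofNat_eq, hqc]; norm_num),
      cast_harmonicOrder (by omega), cast_harmonicOrder (by omega)]
    rw [hP, mul_div_cancel_left₀ _ (pow_ne_zero 2 hF)]
    rw [show ((2 : ℤ_[p]) : ℚ_[p]) = 2 from rfl, hqc] at hz'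
    linear_combination -hz'
  · intro hmod
    obtain ⟨r, hr⟩ : ∃ r, p = 4 * r + 3 := ⟨p / 4, by omega⟩
    rw [show (p - 1) / 2 = 2 * r + 1 by omega]
    obtain ⟨hA, hB⟩ := prod_three_quarters_eq hp hr hq
    obtain ⟨z, hz⟩ := padicGamma_second_difference_sq_congr hp q
    have hz' : padicGamma p (q - 2 * p * q) * padicGamma p (q + 2 * p * q) =
      padicGamma p q ^ 2 + p ^ 2 * z := by linear_combination hz
    rw [hz'] at hA
    -- The explicit factor `p` in `hA` raises the precision from `p ^ 2` to `p ^ 3`.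
    refine ⟨-(q ^ 2 * padicGamma p q ^ 2 * z), ?_⟩
    push_cast
    rw [cast_shiftedFactorial (z := 3 * q) (by rw [PadicInt.coe_mul, coe_ofNat_eq, hqc]; norm_num),
      cast_shiftedFactorial (z := 5 * q) (by rw [PadicInt.coe_mul, coe_ofNat_eq, hqc]; norm_num), hA,
      PadicInt.coe_mul, mul_div_cancel_left₀ _ (PadicInt.coe_ne_zero.2 hB.ne_zero)]
    push_cast
    rw [hqc]
    ring
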